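/- **Setting.** Let $K\ge 2$, and let $\nu_1,\dots,\nu_K$ be probability laws on $\mathbb R$ with finite expectations. Arm $k$ has law $\nu_k$ in the $(\alpha_k,\beta_k,C_k,C')$-second order Pareto family: $\alpha_k,\beta_k,C_k,C'>0$, and its cdf $F_k$ satisfies $|1-C_kx^{-\alpha_k}-F_k(x)|\le C'x^{-\alpha_k(1+\beta_k)}$ for all $x>0$. All $\alpha_k>1$, and the smallest tail index is attained by a single arm $k^\ast$; let $\alpha_{(2)}$ be the second smallest tail index, so $\alpha_{k^\ast}<\alpha_{(2)}$. The rewards $X_{k,t}$ ($1\le k\le K$, $t\ge1$) are independent with $X_{k,t}\sim\nu_k$. A strategy $\pi$ chooses in round $t$ an arm $I_t$ as a measurable function of the arms pulled and the rewards received in the previous rounds, and receives $X_{I_t,t}$. Put $G_n^{(k)}=\max_{1\le t\le n}X_{k,t}$ and $G_n^{(\pi)}=\max_{1\le t\le n}X_{I_t,t}$. The expected extreme regret is $\mathbb E[R_n]=\mathbb E[G_n^{(k^\ast)}]-\mathbb E[G_n^{(\pi)}]$. **Algorithms.** Let $0<b\le\min_k\beta_k$, let $A_0,D,E>0$ be constants,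 and put $N=\lceil A_0(\log n)^{2(2b+1)/b}\rceil$, $\delta_0=n^{-2\alpha_{k^\ast}/(\alpha_{k^\ast}-1)}$. From a sample $x_1,\dots,x_T$ of an arm compute $$\widetilde\alpha=\log\frac{\#\{i:x_i>e^{r}\}}{\#\{i:x_i>e^{r+1}\}}\in[0,\infty]$$ (with $\widetilde\alpha=\infty$ if the denominator is $0$), where $r$ is chosen from the sample (any rule, for instance Lepski's method), and $$\widetilde h=\min(1/\widetilde\alpha,1),\qquad \widetilde C=T^{-2b/(2b+1)}\,\#\{i:x_i\ge T^{\widetilde h/(2b+1)}\}.$$ With $\Lambda_1=D\sqrt{\log(1/\delta_0)}\,T^{-b/(2b+1)}$ and $\Lambda_2=E\sqrt{\log(T/\delta_0)}\,\log(T)\,T^{-b/(2b+1)}$, the index of the arm is $$B=\widetilde\Gamma\bigl(1-\widetilde h-\Lambda_1\bigr)\bigl((\widetilde C+\Lambda_2)\,n\bigr)^{\widetilde h+\Lambda_1},$$ where $\widetilde\Gamma=\Gamma$ on $(0,\infty)$ and $\widetilde\Gamma=+\infty$ elsewhere. Both algorithms first pull each arm $N$ times, in an order fixed in advance. Then ExtremeETC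 selects one arm of maximal index, computed from these samples, and pulls it in all remaining rounds up to the horizon $n$; ExtremeHunter pulls in each remaining round an arm of maximal index, computed from all rewards received so far from each arm. Ties are broken in any way that keeps the algorithm a strategy. **Theorem.** If $b\ge1$ and $\alpha_{(2)}>2\alpha_{k^\ast}^2/(\alpha_{k^\ast}-1)$, then for all large enough $n$ the arm $k^\ast$ is the unique maximizer of $k\mapsto\mathbb E[G_n^{(k)}]$, and the expected extreme regret of ExtremeETC and of ExtremeHunter satisfies, as $n\to\infty$, $$\mathbb E[R_n]=\Omega\left((\log n)^{2(2b+1)/b}\,n^{-(1-1/\alpha_{k^\ast})}\right).$$ That is, there is a constant $c>0$ depending only on $K$, $(\alpha_k,\beta_k,C_k)_k$, $C'$, $b$ and $A_0$ such that, for all large enough $n$, the expectations defining $\mathbb E[R_n]$ are finite and $\mathbb E[R_n]\ge c\,(\log n)^{2(2b+1)/b}\,n^{-(1-1/\alpha_{k^\ast})}$. The threshold on $n$ depends only on these quantities and on the laws $\nu_k$. -/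

import Mathlib

open MeasureTheory ProbabilityTheory Filter
open scoped ENNReal

namespace ExtremeBandit

/-- The `(α, β, C, C')`-second order Pareto family: laws whose cdf `F` satisfies
`|1 - C x ^ (-α) - F x| ≤ C' x ^ (-α (1 + β))`. At `x = 0` the right-hand side is `+∞`, so the
condition bears on `x > 0` only. -/
structure IsSecondOrderPareto (α β C C' : ℝ) (μ : Measure ℝ) : Prop where
  isProbabilityMeasure : IsProbabilityMeasure μ
  alpha_pos : 0 < α
  beta_pos : 0 < β
  C_pos : 0 < C
  C'_pos : 0 < C'
  abs_sub_cdf_le : ∀ x : ℝ, 0 < x →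
    |1 - C * x ^ (-α) - cdf μ x| ≤ C' * x ^ (-(α * (1 + β)))

/-! ### Estimators and index -/

section Index

/-- Number of entries of the sample `x` exceeding `e ^ r`. -/
noncomputable def countAbove (r : ℝ) (x : List ℝ) : ℕ :=
  x.countP (fun y => decide (Real.exp r < y))

/-- `α̃ = log (#{x > e ^ r} / #{x > e ^ (r + 1)})`, an element of `[0, ∞]`, where the threshold
`r = r x` is chosen from the sample. -/
noncomputable def alphaEst (r : List ℝ → ℝ) (x : List ℝ) : ℝ≥0∞ :=
  if countAbove (r x + 1) x = 0 then ⊤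
  else ENNReal.ofReal (Real.log (countAbove (r x) x / countAbove (r x + 1) x))

/-- `h̃ = min (1 / α̃) 1`, with `1 / 0 = ∞` and `1 / ∞ = 0`. -/
noncomputable def hEst (r : List ℝ → ℝ) (x : List ℝ) : ℝ :=
  (min (alphaEst r x)⁻¹ 1).toReal

/-- `C̃ = T ^ (-2b / (2b + 1)) #{x ≥ T ^ (h̃ / (2b + 1))}` where `T` is the sample size. -/
noncomputable def CEst (b : ℝ) (r : List ℝ → ℝ) (x : List ℝ) : ℝ :=
  (x.length : ℝ) ^ (-(2 * b / (2 * b + 1))) *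
    (x.countP (fun y => decide ((x.length : ℝ) ^ (hEst r x / (2 * b + 1)) ≤ y)) : ℝ)

/-- Confidence level `δ₀ = n ^ (-ρ)`, `ρ = 2 a / (a - 1)`, where `a` is the tail index of the
optimal arm. -/
noncomputable def delta0 (a : ℝ) (n : ℕ) : ℝ := (n : ℝ) ^ (-(2 * a / (a - 1)))

noncomputable def Lambda1 (a b D : ℝ) (n T : ℕ) : ℝ :=
  D * √(Real.log (1 / delta0 a n)) * (T : ℝ) ^ (-(b / (2 * b + 1)))

noncomputable def Lambda2 (a b E : ℝ) (n T : ℕ) : ℝ :=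
  E * √(Real.log (T / delta0 a n)) * Real.log T * (T : ℝ) ^ (-(b / (2 * b + 1)))

/-- `Γ` on the positive reals, and `+∞` elsewhere. -/
noncomputable def GammaTilde (x : ℝ) : ℝ≥0∞ :=
  if 0 < x then ENNReal.ofReal (Real.Gamma x) else ⊤

/-- Optimistic index of an arm from which the sample `x` has been observed, for horizon `n`. -/
noncomputable def armIndex (a b D E : ℝ) (r : List ℝ → ℝ) (n : ℕ) (x : List ℝ) : ℝ≥0∞ :=
  GammaTilde (1 - hEst r x - Lambda1 a b D n x.length) *
    ENNReal.ofReal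
      (((CEst b r x + Lambda2 a b E n x.length) * n) ^ (hEst r x + Lambda1 a b D n x.length))

/-- Length of the exploration phase, per arm: `A₀ (log n) ^ (2 (2b + 1) / b)`, rounded up. -/
noncomputable def explorationLength (A₀ b : ℝ) (n : ℕ) : ℕ :=
  ⌈A₀ * Real.log n ^ (2 * (2 * b + 1) / b)⌉₊

end Index

/-! ### Bandit model. Rounds are numbered from `0`: the horizon `n` consists of the rounds `t < n`. -/

section Model

variable {Ω : Type*} [MeasurableSpace Ω] {K : ℕ}

/-- `X k t` is the reward that arm `k` offers in round `t`: independent over all pairs `(k, t)`,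
with law `ν k`. -/
structure IsRewardTable (P : Measure Ω) (ν : Fin K → Measure ℝ) (X : Fin K → ℕ → Ω → ℝ) :
    Prop where
  measurable : ∀ k t, Measurable (X k t)
  law : ∀ k t, P.map (X k t) = ν k
  indep : iIndepFun (fun p : Fin K × ℕ => X p.1 p.2) P

/-- The arm `I t` pulled in round `t` is a measurable function of the arms pulled and the rewards
received in the rounds `s < t`. -/
def IsStrategy (X : Fin K → ℕ → Ω → ℝ) (I : ℕ → Ω → Fin K) : Prop :=
  ∀ t : ℕ, ∃ f : (Fin t → Fin K × ℝ) → Fin K, Measurable f ∧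
    ∀ ω, I t ω = f (fun s => (I s ω, X (I s ω) s ω))

/-- The rewards received from arm `k` in the rounds `s < t`, in chronological order. -/
def samples (X : Fin K → ℕ → Ω → ℝ) (I : ℕ → Ω → Fin K) (k : Fin K) (t : ℕ) (ω : Ω) : List ℝ :=
  ((List.range t).filter (fun s => decide (I s ω = k))).map (fun s => X k s ω)

/-- The first `K N` rounds pull each arm `N` times, in an order fixed in advance. -/
def IsExploration (N : ℕ) (I : ℕ → Ω → Fin K) : Prop :=
  ∃ σ : ℕ → Fin K, (∀ k, ((Finset.range (K * N)).filter (fun t => σ t = k)).card = N) ∧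
    ∀ t < K * N, ∀ ω, I t ω = σ t

/-- `I` is a run of ExtremeETC at horizon `n` with `N` exploration pulls per arm and index function
`B` (of the sample of an arm): after exploration, one arm of maximal index is pulled throughout. -/
structure IsExtremeETC (n N : ℕ) (B : List ℝ → ℝ≥0∞) (X : Fin K → ℕ → Ω → ℝ)
    (I : ℕ → Ω → Fin K) : Prop where
  strategy : IsStrategy X I
  exploration : IsExploration N I
  commit : ∀ ω, ∃ w : Fin K,
    (∀ k, B (samples X I k (K * N) ω) ≤ B (samples X I w (K * N) ω)) ∧
    ∀ t, K * N ≤ t → t < n → I t ω = w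

/-- `I` is a run of ExtremeHunter at horizon `n` with `N` exploration pulls per arm and index
function `B`: after exploration, each round pulls an arm of maximal current index. -/
structure IsExtremeHunter (n N : ℕ) (B : List ℝ → ℝ≥0∞) (X : Fin K → ℕ → Ω → ℝ)
    (I : ℕ → Ω → Fin K) : Prop where
  strategy : IsStrategy X I
  exploration : IsExploration N I
  optimistic : ∀ ω t, K * N ≤ t → t < n →
    ∀ k, B (samples X I k t ω) ≤ B (samples X I (I t ω) t ω)

/-- `G_n^(k)`: the largest reward arm `k` offers in the first `n` rounds. -/
noncomputable def armMax (X : Fin K → ℕ → Ω → ℝ) (k : Fin K) (n : ℕ) (ω : Ω) : ℝ :=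
  ⨆ t : Fin n, X k t ω

/-- `G_n^(π)`: the largest reward received in the first `n` rounds. -/
noncomputable def strategyMax (X : Fin K → ℕ → Ω → ℝ) (I : ℕ → Ω → Fin K) (n : ℕ) (ω : Ω) : ℝ :=
  ⨆ t : Fin n, X (I t ω) t ω

/-- `k` is the unique arm maximizing `E[G_n^(k)]`. -/
def IsOptimalArm (P : Measure Ω) (X : Fin K → ℕ → Ω → ℝ) (n : ℕ) (k : Fin K) : Prop :=
  ∀ j, j ≠ k → (∫ ω, armMax X j n ω ∂P) < ∫ ω, armMax X k n ω ∂P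

/-- Expected extreme regret with respect to the arm `k`. -/
noncomputable def expectedRegret (P : Measure Ω) (X : Fin K → ℕ → Ω → ℝ) (I : ℕ → Ω → Fin K)
    (k : Fin K) (n : ℕ) : ℝ :=
  (∫ ω, armMax X k n ω ∂P) - ∫ ω, strategyMax X I n ω ∂P

end Model

end ExtremeBandit

/-! The lower bound is the price of exploration alone. While the other arms are explored, the
heaviest arm `k` loses at least `N` chances of producing the maximum, and no later choice can
compensate, because the arm pulled in a round is independent of that round's rewards.

Let `F` be the cdf of `k`. If every other cdf exceeds `F` by `δ` at level `x`, conditioning round by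
round (`IsRewardTable.prod_le_real`) gives `P(G_n^(π) ≤ x) ≥ (F + δ) ^ m * F ^ (n - m)`, with `m`
the number of rounds certainly spent off `k`. So the tail of `G_n^(π)` at `x` lies below that of
`G_n^(k)` by at least `m * F ^ n * δ` (`IsRewardTable.real_lt_strategyMax_add_le`). For `x` between
`w = n ^ (1 / a)` and `2 * w`, `F ^ n` is bounded below and `δ` is of order `1 / n`; integrating
over this interval gives a loss of order `m * w / n`.

The cdfs are ordered only above a fixed level `x₀`. Below it, the only cost is the expected
shortfall of `G_n^(k)` under `x₀`, which decays exponentially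
(`IsRewardTable.integral_shortfall_le`). Exploration supplies `m ≥ N`; a constant strategy on
another arm supplies `m = n`, which shows that `k` is optimal. -/

namespace ExtremeBandit

/-! ### Strategies, independence of the current round, and products of cdfs -/

section Strategy

variable {Ω : Type*} {K : ℕ} {X : Fin K → ℕ → Ω → ℝ} {I : ℕ → Ω → Fin K}

theorem measurable_reward [MeasurableSpace Ω] {s : ℕ} (hX : ∀ k, Measurable (X k s))
    (hI : Measurable (I s)) : Measurable (fun ω => X (I s ω) s ω) := by
  have h : Measurable (fun p : Fin K × Ω => X p.1 s p.2) :=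
    measurable_from_prod_countable_right fun k => hX k
  exact h.comp (hI.prodMk measurable_id)

/-- The arm pulled in round `s` depends measurably on the rewards of the previous rounds. -/
theorem IsStrategy.measurable [MeasurableSpace Ω] (h : IsStrategy X I) (t : ℕ)
    (hX : ∀ k, ∀ s < t, Measurable (X k s)) : ∀ s ≤ t, Measurable (I s) := by
  intro s
  induction s using Nat.strong_induction_on with
  | _ s ih =>
    intro hs
    obtain ⟨f, hf, hI⟩ := h s
    rw [show I s = fun ω => f (fun u : Fin s => (I u ω, X (I u ω) u ω)) from funext hI]
    refine hf.comp (measurable_pi_lambda _ fun u => ?_)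
    have hu : Measurable (I u) := ih u u.2 (u.2.le.trans hs)
    exact hu.prodMk (measurable_reward (fun k => hX k u (u.2.trans_le hs)) hu)

theorem isStrategy_const (X : Fin K → ℕ → Ω → ℝ) (j : Fin K) :
    IsStrategy X (fun _ _ => j) :=
  fun _ => ⟨fun _ => j, measurable_const, fun _ => rfl⟩

/-- Only rewards of rounds `s < t` are assumed measurable, so that the σ-algebra can be either the
ambient one or `pastRewards X t`. -/
theorem IsStrategy.measurableSet_forall_reward_le [MeasurableSpace Ω] (h : IsStrategy X I) (t : ℕ)
    (x : ℝ) (hX : ∀ k, ∀ s < t, Measurable (X k s)) :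
    MeasurableSet {ω | ∀ s < t, X (I s ω) s ω ≤ x} := by
  have : {ω | ∀ s < t, X (I s ω) s ω ≤ x} = ⋂ s ∈ Set.Iio t, {ω | X (I s ω) s ω ≤ x} := by
    ext; simp
  rw [this]
  exact MeasurableSet.biInter (Set.to_countable _) fun s hs =>
    (measurable_reward (fun k => hX k s hs) (h.measurable t hX s (le_of_lt hs))) measurableSet_Iic

/-- The information carried by the rewards of all arms in the rounds before `t`. -/
abbrev pastRewards (X : Fin K → ℕ → Ω → ℝ) (t : ℕ) : MeasurableSpace Ω :=
  ⨆ p ∈ {p : Fin K × ℕ | p.2 < t}, MeasurableSpace.comap (X p.1 p.2) inferInstance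

theorem measurable_pastRewards (X : Fin K → ℕ → Ω → ℝ) (t : ℕ) :
    ∀ k, ∀ s < t, Measurable[pastRewards X t] (X k s) := by
  intro k s hs
  rw [measurable_iff_comap_le]
  exact le_iSup₂_of_le (f := fun (p : Fin K × ℕ) (_ : p ∈ {p : Fin K × ℕ | p.2 < t}) =>
    MeasurableSpace.comap (X p.1 p.2) inferInstance) (k, s) hs le_rfl

variable [MeasurableSpace Ω] {P : Measure Ω} {ν : Fin K → Measure ℝ}

/-- The rewards of the rounds before `t` are independent of the reward of arm `k` in round `t`. -/
theorem IsRewardTable.indep_pastRewards (hX : IsRewardTable P ν X) (t : ℕ) (k : Fin K) :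
    Indep (pastRewards X t) (MeasurableSpace.comap (X k t) inferInstance) P := by
  have := indep_iSup_of_disjoint (fun p : Fin K × ℕ => (hX.measurable p.1 p.2).comap_le)
    hX.indep (S := {p : Fin K × ℕ | p.2 < t}) (T := {(k, t)}) (by simp)
  rwa [iSup_singleton] at this

variable [IsProbabilityMeasure P]

theorem IsRewardTable.real_le (hX : IsRewardTable P ν X) (k : Fin K) (t : ℕ) (x : ℝ) :
    P.real {ω | X k t ω ≤ x} = cdf (ν k) x := by
  have : IsProbabilityMeasure (ν k) := by
    rw [← hX.law k t]; exact Measure.isProbabilityMeasure_map (hX.measurable k t).aemeasurable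
  rw [cdf_eq_real, ← hX.law k t, map_measureReal_apply (hX.measurable k t) measurableSet_Iic]
  rfl

/-- One round: the pulled arm is chosen independently of the rewards of the round. -/
theorem IsRewardTable.mul_le_real_forall_reward_le (hX : IsRewardTable P ν X)
    (hI : IsStrategy X I) (t : ℕ) (x q : ℝ) (hq : ∀ ω, q ≤ cdf (ν (I t ω)) x) :
    q * P.real {ω | ∀ s < t, X (I s ω) s ω ≤ x} ≤
      P.real {ω | ∀ s < t + 1, X (I s ω) s ω ≤ x} := by
  have hIt : Measurable (I t) := hI.measurable t (fun k s _ => hX.measurable k s) t le_rfl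
  have hAm := hI.measurableSet_forall_reward_le t x (fun k s _ => hX.measurable k s)
  -- Over the σ-algebra of past rewards, both the event up to round `t` and the choice `I t` are
  -- measurable, hence independent of `X k t` for each fixed `k`.
  have hAp := @IsStrategy.measurableSet_forall_reward_le _ _ _ _ (pastRewards X t) hI t x
    (measurable_pastRewards X t)
  have hIp := @IsStrategy.measurable _ _ _ _ (pastRewards X t) hI t
    (measurable_pastRewards X t) t le_rfl
  set A := {ω | ∀ s < t, X (I s ω) s ω ≤ x} with hA
  have hAk : ∀ k, MeasurableSet[pastRewards X t] (A ∩ I t ⁻¹' {k}) := fun k =>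
    MeasurableSet.inter hAp (hIp (measurableSet_singleton k))
  have hprod : ∀ k, P.real ((A ∩ I t ⁻¹' {k}) ∩ {ω | X k t ω ≤ x}) =
      P.real (A ∩ I t ⁻¹' {k}) * cdf (ν k) x := by
    intro k
    rw [← hX.real_le k t x]
    have := (Indep_iff _ _ _).1 (hX.indep_pastRewards t k) _ {ω | X k t ω ≤ x} (hAk k)
      ⟨Set.Iic x, measurableSet_Iic, rfl⟩
    simp only [Measure.real, this, ENNReal.toReal_mul]
  -- The reward received has a random arm index; on each piece `I t = k` it is the table entry `X k
  -- t`.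
  have hsplit : ∀ B : Set Ω, MeasurableSet B → P.real B = ∑ k, P.real (B ∩ I t ⁻¹' {k}) := by
    intro B hB
    rw [← measureReal_biUnion_finset]
    · congr 1; ext ω; simp
    · intro i _ j _ hij
      refine Set.disjoint_left.2 fun ω h1 h2 => hij ?_
      exact h1.2.symm.trans h2.2
    · exact fun k _ => hB.inter (hIt (measurableSet_singleton k))
  have hB : {ω | ∀ s < t + 1, X (I s ω) s ω ≤ x} = A ∩ {ω | X (I t ω) t ω ≤ x} := by
    ext ω
    simp only [hA, Set.mem_ofPred_eq, Set.mem_inter_iff, Nat.lt_succ_iff_lt_or_eq]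
    exact ⟨fun h => ⟨fun s hs => h s (Or.inl hs), h t (Or.inr rfl)⟩,
      fun h s hs => hs.elim (h.1 s) (fun e => e ▸ h.2)⟩
  have hBm : MeasurableSet {ω | X (I t ω) t ω ≤ x} :=
    measurable_reward (fun k => hX.measurable k t) hIt
      measurableSet_Iic
  rw [hB, hsplit _ (hAm.inter hBm), hsplit A hAm, Finset.mul_sum]
  refine Finset.sum_le_sum fun k _ => ?_
  have hk : A ∩ {ω | X (I t ω) t ω ≤ x} ∩ I t ⁻¹' {k} =
      (A ∩ I t ⁻¹' {k}) ∩ {ω | X k t ω ≤ x} := by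
    ext ω
    simp only [Set.mem_inter_iff, Set.mem_ofPred_eq, Set.mem_preimage, Set.mem_singleton_iff]
    constructor
    · rintro ⟨⟨h1, h2⟩, rfl⟩; exact ⟨⟨h1, rfl⟩, h2⟩
    · rintro ⟨⟨h1, rfl⟩, h2⟩; exact ⟨⟨h1, h2⟩, rfl⟩
  rw [hk, hprod, mul_comm]
  -- The bound `q ≤ cdf (ν k) x` is available only for arms that some `ω` pulls; otherwise both
  -- sides vanish.
  rcases (A ∩ I t ⁻¹' {k}).eq_empty_or_nonempty with h | ⟨ω, -, hω⟩
  · simp [h]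
  · exact mul_le_mul_of_nonneg_left (by simpa [show I t ω = k from hω] using hq ω)
      measureReal_nonneg

/-- If the arm pulled in each round `s < t` has cdf at least `q s` at `x`, then all the rewards
received are at most `x` with probability at least `∏ s, q s`. -/
theorem IsRewardTable.prod_le_real (hX : IsRewardTable P ν X) (hI : IsStrategy X I) (x : ℝ)
    (q : ℕ → ℝ) (t : ℕ) (hq0 : ∀ s < t, 0 ≤ q s) (hq : ∀ s < t, ∀ ω, q s ≤ cdf (ν (I s ω)) x) :
    ∏ s ∈ Finset.range t, q s ≤ P.real {ω | ∀ s < t, X (I s ω) s ω ≤ x} := by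
  induction t with
  | zero => simp
  | succ t ih =>
    rw [Finset.prod_range_succ, mul_comm]
    exact (mul_le_mul_of_nonneg_left (ih (fun s hs => hq0 s (hs.trans t.lt_succ_self))
      fun s hs => hq s (hs.trans t.lt_succ_self)) (hq0 t t.lt_succ_self)).trans
      (hX.mul_le_real_forall_reward_le hI t x (q t) (hq t t.lt_succ_self))

/-- The rewards of a single arm are at most `x` in `n` rounds with probability `F x ^ n`. -/
theorem IsRewardTable.real_forall_le (hX : IsRewardTable P ν X) (k : Fin K) (n : ℕ) (x : ℝ) :
    P.real {ω | ∀ s < n, X k s ω ≤ x} = cdf (ν k) x ^ n := by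
  have h := (hX.indep.precomp (g := fun s : ℕ => (k, s))
    (fun a b h => (Prod.mk.inj h).2)).measure_inter_preimage_eq_mul (Finset.range n)
    (sets := fun _ => Set.Iic x) (fun _ _ => measurableSet_Iic)
  have e : {ω | ∀ s < n, X k s ω ≤ x} = ⋂ s ∈ Finset.range n, X k s ⁻¹' Set.Iic x := by
    ext; simp
  rw [e, Measure.real]
  refine (congrArg ENNReal.toReal h).trans ?_
  rw [ENNReal.toReal_prod]
  calc _ = ∏ s ∈ Finset.range n, cdf (ν k) x :=
        Finset.prod_congr rfl fun s _ => hX.real_le k s x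
    _ = _ := by simp

end Strategy

/-! ### Comparing expectations through tails (layer cake) -/

section Tail

variable {Ω : Type*} [MeasurableSpace Ω] {P : Measure Ω} [IsProbabilityMeasure P]

/-- Tail comparison with a gain `d` on `(u, v]` yields a gain `d (v - u)` in expectation. -/
theorem integral_add_le_integral_of_tail {f g : Ω → ℝ} (hf : Integrable f P)
    (hg : Integrable g P) (hf0 : 0 ≤ f) (hg0 : 0 ≤ g) {u v d : ℝ} (hu : 0 ≤ u) (huv : u ≤ v)
    (hd : 0 ≤ d) (h : ∀ y, 0 < y → P.real {ω | y < f ω} ≤ P.real {ω | y < g ω})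
    (h' : ∀ y, u < y → y ≤ v → P.real {ω | y < f ω} + d ≤ P.real {ω | y < g ω}) :
    (∫ ω, f ω ∂P) + d * (v - u) ≤ ∫ ω, g ω ∂P := by
  have key : (∫⁻ ω, ENNReal.ofReal (f ω) ∂P) + ENNReal.ofReal d * ENNReal.ofReal (v - u) ≤
      ∫⁻ ω, ENNReal.ofReal (g ω) ∂P := by
    rw [lintegral_eq_lintegral_meas_lt P (ae_of_all _ hf0) hf.aemeasurable,
      lintegral_eq_lintegral_meas_lt P (ae_of_all _ hg0) hg.aemeasurable]
    have e : ENNReal.ofReal d * ENNReal.ofReal (v - u) =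
        ∫⁻ y in Set.Ioi (0 : ℝ), (Set.Ioc u v).indicator (fun _ => ENNReal.ofReal d) y := by
      have hs : Set.Ioc u v ⊆ Set.Ioi 0 := fun y hy => lt_of_le_of_lt hu hy.1
      rw [lintegral_indicator measurableSet_Ioc, lintegral_const, Measure.restrict_restrict
        measurableSet_Ioc, Set.inter_eq_left.2 hs]
      simp
    rw [e, ← lintegral_add_right _ (measurable_const.indicator measurableSet_Ioc)]
    refine setLIntegral_mono' measurableSet_Ioi fun y hy => ?_
    by_cases hy' : y ∈ Set.Ioc u v
    · rw [Set.indicator_of_mem hy', ← ofReal_measureReal (μ := P) (s := {a | y < f a}),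
        ← ofReal_measureReal (μ := P) (s := {a | y < g a}), ← ENNReal.ofReal_add
        measureReal_nonneg hd]
      exact ENNReal.ofReal_le_ofReal (h' y hy'.1 hy'.2)
    · rw [Set.indicator_of_notMem hy', add_zero, ← ofReal_measureReal (μ := P) (s := {a | y < f a}),
        ← ofReal_measureReal (μ := P) (s := {a | y < g a})]
      exact ENNReal.ofReal_le_ofReal (h y hy)
  rw [← ofReal_integral_eq_lintegral_ofReal hf (ae_of_all _ hf0),
    ← ofReal_integral_eq_lintegral_ofReal hg (ae_of_all _ hg0), ← ENNReal.ofReal_mul hd,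
    ← ENNReal.ofReal_add (integral_nonneg hf0) (mul_nonneg hd (sub_nonneg.2 huv))] at key
  exact (ENNReal.ofReal_le_ofReal_iff (integral_nonneg hg0)).1 key

/-- If the tail of `f` is at most `q` times the tail of `g`, then `E f ≤ q E g`. -/
theorem integral_le_mul_integral_of_tail {f g : Ω → ℝ} (hf : Integrable f P)
    (hg : Integrable g P) (hf0 : 0 ≤ f) (hg0 : 0 ≤ g) {q : ℝ} (hq : 0 ≤ q)
    (h : ∀ y, 0 < y → P.real {ω | y < f ω} ≤ q * P.real {ω | y < g ω}) :
    ∫ ω, f ω ∂P ≤ q * ∫ ω, g ω ∂P := by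
  have key : (∫⁻ ω, ENNReal.ofReal (f ω) ∂P) ≤
      ENNReal.ofReal q * ∫⁻ ω, ENNReal.ofReal (g ω) ∂P := by
    rw [lintegral_eq_lintegral_meas_lt P (ae_of_all _ hf0) hf.aemeasurable,
      lintegral_eq_lintegral_meas_lt P (ae_of_all _ hg0) hg.aemeasurable,
      ← lintegral_const_mul' _ _ ENNReal.ofReal_ne_top]
    refine setLIntegral_mono' measurableSet_Ioi fun y hy => ?_
    rw [← ofReal_measureReal (μ := P) (s := {a | y < f a}),
        ← ofReal_measureReal (μ := P) (s := {a | y < g a}), ← ENNReal.ofReal_mul hq]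
    exact ENNReal.ofReal_le_ofReal (h y hy)
  rw [← ofReal_integral_eq_lintegral_ofReal hf (ae_of_all _ hf0),
    ← ofReal_integral_eq_lintegral_ofReal hg (ae_of_all _ hg0), ← ENNReal.ofReal_mul hq] at key
  exact (ENNReal.ofReal_le_ofReal_iff (mul_nonneg hq (integral_nonneg hg0))).1 key

end Tail

/-! ### Integrability of rewards and of maxima -/

section Pareto

variable {α β C C' : ℝ} {μ : Measure ℝ}

/-- The tail is at most `(C + C') * y ^ (-α)` for `y > 1`, which is integrable because `α > 1`; this
settles the positive part. -/
theorem IsSecondOrderPareto.integrable_id (h : IsSecondOrderPareto α β C C' μ) (hα : 1 < α)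
    (hneg : Integrable (fun x : ℝ => min x 0) μ) : Integrable (fun x : ℝ => x) μ := by
  have := h.isProbabilityMeasure
  have hpos : Integrable (fun x : ℝ => max x 0) μ := by
    refine ⟨by fun_prop, ?_⟩
    have h0 : 0 ≤ᵐ[μ] fun x : ℝ => max x 0 := ae_of_all _ fun x => le_max_right _ _
    rw [hasFiniteIntegral_iff_ofReal h0, lintegral_eq_lintegral_meas_lt μ h0 (by fun_prop)]
    have hsplit : Set.Ioi (0 : ℝ) = Set.Ioc 0 1 ∪ Set.Ioi 1 :=
      (Set.Ioc_union_Ioi_eq_Ioi zero_le_one).symm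
    rw [hsplit]
    refine (lintegral_union_le _ _ _).trans_lt (ENNReal.add_lt_top.2 ⟨?_, ?_⟩)
    · calc _ ≤ ∫⁻ _ in Set.Ioc (0 : ℝ) 1, 1 := lintegral_mono fun y => prob_le_one
        _ < ⊤ := by simp
    · have hint : IntegrableOn (fun y : ℝ => (C + C') * y ^ (-α)) (Set.Ioi 1) :=
        (integrableOn_Ioi_rpow_of_lt (by linarith) one_pos).const_mul _
      refine lt_of_le_of_lt (setLIntegral_mono' measurableSet_Ioi fun y hy => ?_)
        hint.lintegral_lt_top
      have hy1 : (1 : ℝ) < y := hy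
      have hy0 : (0 : ℝ) < y := by linarith
      rw [← ofReal_measureReal]
      refine ENNReal.ofReal_le_ofReal ?_
      have e : {a : ℝ | y < max a 0} = (Set.Iic y)ᶜ := by
        ext a; simp [hy0.le]
      rw [e, probReal_compl_eq_one_sub measurableSet_Iic, ← cdf_eq_real]
      have h1 := abs_le.1 (h.abs_sub_cdf_le y hy0)
      have h2 : y ^ (-(α * (1 + β))) ≤ y ^ (-α) := by
        refine Real.rpow_le_rpow_of_exponent_le hy1.le ?_
        nlinarith [mul_pos h.alpha_pos h.beta_pos]
      nlinarith [mul_le_mul_of_nonneg_left h2 h.C'_pos.le, h1.2]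
  refine (hpos.add hneg).congr (ae_of_all _ fun x => ?_)
  simp [max_add_min]

end Pareto

section MaxIntegrable

variable {Ω : Type*} {K : ℕ} {X : Fin K → ℕ → Ω → ℝ} {I : ℕ → Ω → Fin K}

theorem strategyMax_le_iff {n : ℕ} (hn : 0 < n) (ω : Ω) (x : ℝ) :
    strategyMax X I n ω ≤ x ↔ ∀ s < n, X (I s ω) s ω ≤ x := by
  have : Nonempty (Fin n) := ⟨⟨0, hn⟩⟩
  rw [strategyMax, ciSup_le_iff (Set.finite_range _).bddAbove]
  exact ⟨fun h s hs => h ⟨s, hs⟩, fun h s => h s s.2⟩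

theorem strategyMax_const (k : Fin K) (n : ℕ) :
    strategyMax X (fun _ _ => k) n = armMax X k n := rfl

variable [MeasurableSpace Ω] {P : Measure Ω} {ν : Fin K → Measure ℝ}

theorem IsRewardTable.integrable_strategyMax (hX : IsRewardTable P ν X) (hI : IsStrategy X I)
    (hν : ∀ k, Integrable (fun x : ℝ => x) (ν k)) (n : ℕ) :
    Integrable (strategyMax X I n) P := by
  have hXint : ∀ k t, Integrable (X k t) P := fun k t => by
    have := hν k
    rw [← hX.law k t, integrable_map_measure (by fun_prop) (hX.measurable k t).aemeasurable] at this
    exact this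
  have hm : ∀ s, Measurable (fun ω => X (I s ω) s ω) := fun s =>
    measurable_reward (fun k => hX.measurable k s)
      (hI.measurable s (fun k u _ => hX.measurable k u) s le_rfl)
  have hsum : Integrable (fun ω => ∑ k : Fin K, ∑ t : Fin n, |X k t ω|) P :=
    integrable_finsetSum _ fun k _ => integrable_finsetSum _ fun t _ => (hXint k t).abs
  refine hsum.mono' (Measurable.iSup fun t : Fin n => hm t).aestronglyMeasurable
    (ae_of_all _ fun ω => ?_)
  have hb : ∀ t : Fin n, |X (I t ω) t ω| ≤ ∑ k : Fin K, ∑ t : Fin n, |X k t ω| := fun t =>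
    (Finset.single_le_sum (f := fun t : Fin n => |X (I t ω) t ω|) (fun _ _ => abs_nonneg _)
      (Finset.mem_univ t)).trans <| by
      rw [Finset.sum_comm]
      exact Finset.sum_le_sum fun t _ => Finset.single_le_sum (f := fun k => |X k t ω|)
        (fun _ _ => abs_nonneg _) (Finset.mem_univ _)
  rcases n.eq_zero_or_pos with rfl | hn
  · simp [strategyMax]
  · have : Nonempty (Fin n) := ⟨⟨0, hn⟩⟩
    rw [Real.norm_eq_abs, abs_le]
    refine ⟨?_, ciSup_le fun t => (le_abs_self _).trans (hb t)⟩
    exact (neg_le_of_abs_le (hb ⟨0, hn⟩)).trans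
      (le_ciSup (f := fun t : Fin n => X (I t ω) t ω) (Set.finite_range _).bddAbove ⟨0, hn⟩)

end MaxIntegrable

/-! ### Tail asymptotics and elementary inequalities -/

section ParetoTail

theorem eventually_rpow_neg_le_mul {a p ε : ℝ} (hap : a < p) (hε : 0 < ε) :
    ∀ᶠ x : ℝ in atTop, x ^ (-p) ≤ ε * x ^ (-a) := by
  have h := (tendsto_rpow_neg_atTop (sub_pos.2 hap)).eventually_le_const hε
  filter_upwards [h, eventually_gt_atTop 0] with x hx hx0
  rw [show -p = -(p - a) + -a by ring, Real.rpow_add hx0]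
  exact mul_le_mul_of_nonneg_right hx (Real.rpow_nonneg hx0.le _)

variable {α β C C' : ℝ} {μ : Measure ℝ}

/-- Since `β > 0`, the second-order error is eventually at most a quarter of the main term. -/
theorem IsSecondOrderPareto.eventually_cdf_mem (h : IsSecondOrderPareto α β C C' μ) :
    ∀ᶠ x : ℝ in atTop, 1 - 5 / 4 * (C * x ^ (-α)) ≤ cdf μ x ∧
      cdf μ x ≤ 1 - 3 / 4 * (C * x ^ (-α)) := by
  have hlt : α < α * (1 + β) := by nlinarith [mul_pos h.alpha_pos h.beta_pos]
  have hε : 0 < C / (4 * C') := div_pos h.C_pos (by linarith [h.C'_pos])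
  filter_upwards [eventually_rpow_neg_le_mul hlt hε, eventually_gt_atTop 0] with x hx hx0
  have h1 := abs_le.1 (h.abs_sub_cdf_le x hx0)
  have h2 := mul_le_mul_of_nonneg_left hx h.C'_pos.le
  have h3 : C' * (C / (4 * C') * x ^ (-α)) = 1 / 4 * (C * x ^ (-α)) := by
    have := h.C'_pos.ne'
    field_simp
  constructor <;> linarith [h1.1, h1.2]

/-- A larger tail index makes the tail negligible against `x ^ (-a)`, whatever the constant. This
separates the other arms from the heaviest one. -/
theorem IsSecondOrderPareto.eventually_le_cdf (h : IsSecondOrderPareto α β C C' μ) {a c : ℝ}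
    (ha : a < α) (hc : 0 < c) : ∀ᶠ x : ℝ in atTop, 1 - c * x ^ (-a) ≤ cdf μ x := by
  have hε : 0 < c / (5 / 4 * C) := div_pos hc (by linarith [h.C_pos])
  filter_upwards [h.eventually_cdf_mem, eventually_rpow_neg_le_mul ha hε] with x h1 h2
  have h3 := mul_le_mul_of_nonneg_left h2 (by linarith [h.C_pos] : 0 ≤ 5 / 4 * C)
  have h4 : 5 / 4 * C * (c / (5 / 4 * C) * x ^ (-a)) = c * x ^ (-a) := by
    have := h.C_pos.ne'
    field_simp
  linarith [h1.1]

end ParetoTail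

/-- Induction on `L ^ (m + 1) - F ^ (m + 1) = L * (L ^ m - F ^ m) + F ^ m * (L - F)`. The natural
factor `F ^ (m - 1)` is weakened to `F ^ m`, which later combines with `F ^ (n - m)` to `F ^ n`. -/
theorem mul_pow_mul_sub_le_pow_sub_pow {F L : ℝ} (hF : 0 ≤ F) (hF1 : F ≤ 1) (hFL : F ≤ L)
    (m : ℕ) : m * F ^ m * (L - F) ≤ L ^ m - F ^ m := by
  induction m with
  | zero => simp
  | succ m ih =>
    have hp : 0 ≤ F ^ m := pow_nonneg hF m
    have hd : 0 ≤ L - F := sub_nonneg.2 hFL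
    have h1 : 0 ≤ m * F ^ m * (L - F) := by positivity
    have h2 : F * (m * F ^ m * (L - F)) ≤ L * (L ^ m - F ^ m) :=
      mul_le_mul hFL ih h1 (hF.trans hFL)
    have h3 : F * (F ^ m * (L - F)) ≤ 1 * (F ^ m * (L - F)) :=
      mul_le_mul_of_nonneg_right hF1 (mul_nonneg hp hd)
    push_cast
    rw [pow_succ, pow_succ]
    linarith

/-- Combine `1 + 2 * y ≤ exp (2 * y)` with `(1 - y) * (1 + 2 * y) = 1 + y * (1 - 2 * y) ≥ 1`. -/
theorem exp_neg_two_mul_le_one_sub {y : ℝ} (h0 : 0 ≤ y) (h1 : y ≤ 1 / 2) :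
    Real.exp (-(2 * y)) ≤ 1 - y := by
  rw [Real.exp_neg]
  have h2 : 1 + 2 * y ≤ Real.exp (2 * y) := by linarith [Real.add_one_le_exp (2 * y)]
  refine (inv_anti₀ (by linarith) h2).trans ?_
  rw [inv_le_iff_one_le_mul₀ (by linarith)]
  nlinarith

/-! ### Cost of rounds played off the heaviest arm -/

section Comparison

variable {Ω : Type*} [MeasurableSpace Ω] {K : ℕ} {X : Fin K → ℕ → Ω → ℝ} {I : ℕ → Ω → Fin K}
  {P : Measure Ω} [IsProbabilityMeasure P] {ν : Fin K → Measure ℝ}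

theorem IsRewardTable.real_lt_strategyMax (hX : IsRewardTable P ν X) (hI : IsStrategy X I)
    {n : ℕ} (hn : 0 < n) (x : ℝ) : P.real {ω | x < strategyMax X I n ω} =
      1 - P.real {ω | ∀ s < n, X (I s ω) s ω ≤ x} := by
  rw [← probReal_compl_eq_one_sub
    (hI.measurableSet_forall_reward_le n x fun k s _ => hX.measurable k s)]
  congr 1
  ext ω
  simp only [Set.mem_ofPred_eq, Set.mem_compl_iff, ← strategyMax_le_iff hn ω x, not_le]

/-- At a level where the cdf `F` of arm `k` is below those of all other arms by at least `δ`,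
playing other arms in the rounds of `S` lowers the tail of the maximum by `#S F ^ n δ`. -/
theorem IsRewardTable.real_lt_strategyMax_add_le (hX : IsRewardTable P ν X)
    (hI : IsStrategy X I) {n : ℕ} (hn : 0 < n) {k : Fin K} {x δ : ℝ} (hδ : 0 ≤ δ)
    (hdom : ∀ j, j ≠ k → cdf (ν k) x + δ ≤ cdf (ν j) x) {S : Finset ℕ}
    (hS : S ⊆ Finset.range n) (hIS : ∀ s ∈ S, ∀ ω, I s ω ≠ k) :
    P.real {ω | x < strategyMax X I n ω} + S.card * cdf (ν k) x ^ n * δ ≤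
      P.real {ω | x < armMax X k n ω} := by
  set F := cdf (ν k) x with hF
  have hF0 : 0 ≤ F := cdf_nonneg _ _
  have hF1 : F ≤ 1 := cdf_le_one _ _
  rw [← strategyMax_const, hX.real_lt_strategyMax hI hn,
    hX.real_lt_strategyMax (isStrategy_const X k) hn, hX.real_forall_le k n x]
  -- Outside `S` any arm may be pulled, and `F` is still a lower bound because it is the smallest
  -- cdf at `x`.
  have hprod := hX.prod_le_real hI x (fun s => if s ∈ S then F + δ else F) n
    (fun s _ => by split_ifs <;> positivity)
    (fun s _ ω => by
      by_cases hk : I s ω = k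
      · have : s ∉ S := fun hs => hIS s hs ω hk
        simp [this, hk, hF]
      · have := hdom _ hk
        split_ifs <;> linarith)
  rw [Finset.prod_ite, Finset.prod_const, Finset.prod_const,
    Finset.filter_mem_eq_inter, Finset.inter_eq_right.2 hS, Finset.filter_notMem_eq_sdiff,
    Finset.card_sdiff_of_subset hS, Finset.card_range] at hprod
  have hcard : S.card ≤ n := by simpa using Finset.card_le_card hS
  have h1 := mul_le_mul_of_nonneg_right
    (mul_pow_mul_sub_le_pow_sub_pow hF0 hF1 (by linarith : F ≤ F + δ) S.card)
    (pow_nonneg hF0 (n - S.card))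
  have h2 : F ^ n = F ^ S.card * F ^ (n - S.card) := by
    rw [← pow_add, Nat.add_sub_cancel' hcard]
  have h3 : S.card * F ^ S.card * (F + δ - F) * F ^ (n - S.card) = S.card * F ^ n * δ := by
    rw [h2]; ring
  rw [h3, sub_mul, ← h2] at h1
  linarith

/-- The expected shortfall of `G_n^(k)` below a level `x` is exponentially small. -/
theorem IsRewardTable.integral_shortfall_le (hX : IsRewardTable P ν X)
    (hν : ∀ k, Integrable (fun x : ℝ => x) (ν k)) {n : ℕ} (hn : 0 < n) (k : Fin K) (x : ℝ) :
    ∫ ω, max (x - armMax X k n ω) 0 ∂P ≤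
      cdf (ν k) x ^ (n - 1) * ∫ y, max (x + 1 - y) 0 ∂(ν k) := by
  have hG : Integrable (armMax X k n) P := hX.integrable_strategyMax (isStrategy_const X k) hν n
  have : IsProbabilityMeasure (ν k) := by
    rw [← hX.law k 0]; exact Measure.isProbabilityMeasure_map (hX.measurable k 0).aemeasurable
  have hg : Integrable (fun y : ℝ => max (x + 1 - y) 0) (ν k) :=
    ((integrable_const _).sub (hν k)).sup (integrable_const 0)
  have e : ∫ y, max (x + 1 - y) 0 ∂(ν k) = ∫ ω, max (x + 1 - X k 0 ω) 0 ∂P := by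
    rw [← hX.law k 0, integral_map (hX.measurable k 0).aemeasurable (by fun_prop)]
  rw [← hX.law k 0, integrable_map_measure (by fun_prop) (hX.measurable k 0).aemeasurable] at hg
  rw [e]
  -- Of the `n` factors of `P(G ≤ x - y) = F (x - y) ^ n`, one is kept as an integrable tail in `y`
  -- and the others are bounded by `F x`. The shift to `x + 1` turns `X ≤ x - y` into a strict
  -- inequality.
  refine integral_le_mul_integral_of_tail
    (((integrable_const x).sub hG).sup (integrable_const 0)) hg (fun ω => le_max_right _ _)
    (fun ω => le_max_right _ _) (pow_nonneg (cdf_nonneg _ _) _) fun y hy => ?_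
  have h1 : P.real {ω | y < max (x - armMax X k n ω) 0} ≤
      P.real {ω | ∀ s < n, X k s ω ≤ x - y} := by
    refine measureReal_mono fun ω hω => ?_
    have hω' : y < x - armMax X k n ω := (lt_max_iff.1 hω).resolve_right hy.not_gt
    have := (strategyMax_le_iff (X := X) (I := fun _ _ => k) hn ω (x - y)).1
      (by rw [strategyMax_const]; linarith)
    exact this
  have h2 : P.real {ω | X k 0 ω ≤ x - y} ≤ P.real {ω | y < max (x + 1 - X k 0 ω) 0} := by
    refine measureReal_mono fun ω hω => ?_
    have hω' : X k 0 ω ≤ x - y := hω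
    have h : y < x + 1 - X k 0 ω := by linarith
    exact lt_max_of_lt_left h
  have h3 : cdf (ν k) (x - y) ^ (n - 1) ≤ cdf (ν k) x ^ (n - 1) :=
    pow_le_pow_left₀ (cdf_nonneg _ _) (monotone_cdf _ (by linarith)) _
  rw [hX.real_forall_le] at h1
  rw [hX.real_le] at h2
  refine h1.trans ?_
  obtain ⟨m, rfl⟩ : ∃ m, n = m + 1 := ⟨n - 1, by omega⟩
  rw [pow_succ]
  exact mul_le_mul h3 h2 (cdf_nonneg _ _) (pow_nonneg (cdf_nonneg _ _) _)

/-- Rounds in which the heaviest-tailed arm `k` is certainly not played each cost at least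
`exp (-5C/2) C 2 ^ (-a) / 2 * n ^ (1/a) / n` in expectation, up to an exponentially small term. -/
theorem IsRewardTable.integral_strategyMax_add_le (hX : IsRewardTable P ν X)
    (hI : IsStrategy X I) (hν : ∀ k, Integrable (fun x : ℝ => x) (ν k)) {n : ℕ} (hn : 0 < n)
    {k : Fin K} {a C x₀ : ℝ} (ha : 0 < a) (hC : 0 < C) (hx₀ : 0 < x₀)
    (hmem : ∀ x, x₀ ≤ x → 1 - 5 / 4 * (C * x ^ (-a)) ≤ cdf (ν k) x ∧
      cdf (ν k) x ≤ 1 - 3 / 4 * (C * x ^ (-a)))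
    (hdom : ∀ j, j ≠ k → ∀ x, x₀ ≤ x → 1 - 1 / 4 * (C * x ^ (-a)) ≤ cdf (ν j) x)
    (hxn : x₀ ≤ (n : ℝ) ^ (1 / a)) (hCn : 5 / 4 * (C / n) ≤ 1 / 2)
    {S : Finset ℕ} (hS : S ⊆ Finset.range n) (hIS : ∀ s ∈ S, ∀ ω, I s ω ≠ k) :
    (∫ ω, strategyMax X I n ω ∂P) +
        S.card * (Real.exp (-(5 / 2 * C)) * C * 2 ^ (-a) / 2) * ((n : ℝ) ^ (1 / a) / n) ≤
      (∫ ω, armMax X k n ω ∂P) +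
        cdf (ν k) x₀ ^ (n - 1) * ∫ y, max (x₀ + 1 - y) 0 ∂(ν k) := by
  have hn' : (0 : ℝ) < n := Nat.cast_pos.2 hn
  set w := (n : ℝ) ^ (1 / a) with hw
  have hw0 : 0 < w := Real.rpow_pos_of_pos hn' _
  have hwa : w ^ (-a) = 1 / n := by
    rw [hw, ← Real.rpow_mul hn'.le, show 1 / a * -a = -1 by field_simp, Real.rpow_neg_one, one_div]
  have hG : Integrable (armMax X k n) P := hX.integrable_strategyMax (isStrategy_const X k) hν n
  have hGπ : Integrable (strategyMax X I n) P := hX.integrable_strategyMax hI hν n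
  -- The excesses over `x₀` are compared, since the cdfs are ordered only from `x₀` on.
  have hexc : ∀ G : Ω → ℝ, Integrable G P → Integrable (fun ω => max (G ω - x₀) 0) P :=
    fun G hG => (hG.sub (integrable_const x₀)).sup (integrable_const 0)
  -- The factor `1 / 2` is `3 / 4 - 1 / 4`, from `hmem` and `hdom`.
  have htail : ∀ x, x₀ ≤ x → P.real {ω | x < strategyMax X I n ω} +
      S.card * cdf (ν k) x ^ n * (1 / 2 * (C * x ^ (-a))) ≤ P.real {ω | x < armMax X k n ω} :=
    fun x hx => hX.real_lt_strategyMax_add_le hI hn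
      (by have := Real.rpow_nonneg (hx₀.le.trans hx) (-a); positivity)
      (fun j hj => by linarith [hdom j hj x hx, (hmem x hx).2]) hS hIS
  have hset : ∀ (G : Ω → ℝ) (y : ℝ), 0 < y →
      {ω | y < max (G ω - x₀) 0} = {ω | x₀ + y < G ω} := fun G y hy => by
    ext ω
    simp only [Set.mem_ofPred_eq, lt_max_iff, hy.not_gt, or_false]
    constructor <;> intro h <;> linarith
  -- The gain is collected for levels `x₀ + y` in `(w, 2 * w]`: there `x ^ (-a)` lies between `2 ^
  -- (-a) / n` and `1 / n`, so `F ^ n ≥ exp (-5 * C / 2)`.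
  have key := integral_add_le_integral_of_tail (hexc _ hGπ) (hexc _ hG)
    (fun ω => le_max_right _ _) (fun ω => le_max_right _ _) (u := w - x₀) (v := 2 * w - x₀)
    (d := S.card * (Real.exp (-(5 / 2 * C)) * C * 2 ^ (-a) / 2) * (1 / n))
    (by linarith) (by linarith) (by positivity)
    (fun y hy => by
      rw [hset _ y hy, hset _ y hy]
      have h0 := Real.rpow_nonneg (by linarith : 0 ≤ x₀ + y) (-a)
      have h1 := htail (x₀ + y) (by linarith)
      have h2 : 0 ≤ S.card * cdf (ν k) (x₀ + y) ^ n * (1 / 2 * (C * (x₀ + y) ^ (-a))) :=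
        mul_nonneg (mul_nonneg (Nat.cast_nonneg _) (pow_nonneg (cdf_nonneg _ _) _))
          (by positivity)
      linarith)
    (fun y hy1 hy2 => by
      have hy : 0 < y := by linarith
      rw [hset _ y hy, hset _ y hy]
      refine le_trans (add_le_add le_rfl ?_) (htail (x₀ + y) (by linarith))
      have hup : (x₀ + y) ^ (-a) ≤ 1 / n := by
        rw [← hwa]; exact Real.rpow_le_rpow_of_nonpos hw0 (by linarith) (by linarith)
      have hlow : 2 ^ (-a) * (1 / n : ℝ) ≤ (x₀ + y) ^ (-a) := by
        rw [← hwa, ← Real.mul_rpow zero_le_two hw0.le]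
        exact Real.rpow_le_rpow_of_nonpos (by linarith) (by linarith) (by linarith)
      have hF : Real.exp (-(2 * (5 / 4 * (C / n)))) ≤ cdf (ν k) (x₀ + y) := by
        refine (exp_neg_two_mul_le_one_sub (by positivity) hCn).trans
          (le_trans ?_ (hmem (x₀ + y) (by linarith)).1)
        have := mul_le_mul_of_nonneg_left hup hC.le
        rw [mul_one_div] at this
        linarith
      have hFn : Real.exp (-(5 / 2 * C)) ≤ cdf (ν k) (x₀ + y) ^ n := by
        refine le_trans (le_of_eq ?_) (pow_le_pow_left₀ (Real.exp_pos _).le hF n)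
        rw [← Real.exp_nat_mul]
        congr 1
        field_simp
        ring
      calc S.card * (Real.exp (-(5 / 2 * C)) * C * 2 ^ (-a) / 2) * (1 / n : ℝ)
          = S.card * (Real.exp (-(5 / 2 * C)) * (1 / 2 * (C * (2 ^ (-a) * (1 / n))))) := by ring
        _ ≤ S.card * (cdf (ν k) (x₀ + y) ^ n * (1 / 2 * (C * (x₀ + y) ^ (-a)))) := by
            refine mul_le_mul_of_nonneg_left ?_ (Nat.cast_nonneg _)
            exact mul_le_mul hFn (by gcongr) (by positivity) (pow_nonneg (cdf_nonneg _ _) _)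
        _ = _ := by ring)
  have hshort := hX.integral_shortfall_le hν hn k x₀
  -- For the strategy an upper bound suffices, so its own shortfall below `x₀` is dropped; for arm
  -- `k` the identity must be exact.
  have hπ : (∫ ω, strategyMax X I n ω ∂P) ≤
      x₀ + ∫ ω, max (strategyMax X I n ω - x₀) 0 ∂P := by
    calc _ ≤ ∫ ω, (x₀ + max (strategyMax X I n ω - x₀) 0) ∂P :=
          integral_mono hGπ ((integrable_const _).add (hexc _ hGπ)) fun ω => by
            have := le_max_left (strategyMax X I n ω - x₀) 0
            linarith
      _ = _ := by rw [integral_add (integrable_const _) (hexc _ hGπ)]; simp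
  have hk : (∫ ω, armMax X k n ω ∂P) + ∫ ω, max (x₀ - armMax X k n ω) 0 ∂P =
      x₀ + ∫ ω, max (armMax X k n ω - x₀) 0 ∂P := by
    have hs : Integrable (fun ω => max (x₀ - armMax X k n ω) 0) P :=
      ((integrable_const x₀).sub hG).sup (integrable_const 0)
    rw [← integral_add hG hs]
    calc _ = ∫ ω, (x₀ + max (armMax X k n ω - x₀) 0) ∂P := integral_congr_ae <|
          ae_of_all _ fun ω => by
            change armMax X k n ω + max (x₀ - armMax X k n ω) 0 =
              x₀ + max (armMax X k n ω - x₀) 0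
            rcases le_total (armMax X k n ω) x₀ with h | h
            · rw [max_eq_left (by linarith), max_eq_right (by linarith)]; ring
            · rw [max_eq_right (by linarith), max_eq_left (by linarith)]; ring
      _ = _ := by rw [integral_add (integrable_const _) (hexc _ hG)]; simp
  have harith : S.card * (Real.exp (-(5 / 2 * C)) * C * 2 ^ (-a) / 2) * (1 / n : ℝ) *
      (2 * w - x₀ - (w - x₀)) =
      S.card * (Real.exp (-(5 / 2 * C)) * C * 2 ^ (-a) / 2) * (w / n) := by ring
  rw [harith] at key
  linarith

end Comparison

/-! ### Size of the error term and of the exploration phase -/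

section Exploration

/-- Here `n * q ^ (n - 1)` tends to `0` and `n ^ s ≥ 1`. This absorbs the shortfall into the main
term. -/
theorem eventually_pow_mul_le {q M ε s : ℝ} (hq0 : 0 ≤ q) (hq : q < 1) (hε : 0 < ε)
    (hs : 0 ≤ s) :
    ∀ᶠ n : ℕ in atTop, q ^ (n - 1) * M ≤ ε * ((n : ℝ) ^ s / n) := by
  have h1 : Tendsto (fun n : ℕ => ((n : ℝ) * q ^ n + q ^ n) * M) atTop (nhds ((0 + 0) * M)) :=
    ((tendsto_self_mul_const_pow_of_lt_one hq0 hq).add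
      (tendsto_pow_atTop_nhds_zero_of_lt_one hq0 hq)).mul_const M
  have h2 := (h1.eventually_le_const (by simpa using hε)).and (eventually_ge_atTop 0)
  filter_upwards [(tendsto_sub_atTop_nat 1).eventually h2, eventually_ge_atTop 1] with n h hn
  obtain ⟨m, rfl⟩ : ∃ m, n = m + 1 := ⟨n - 1, by omega⟩
  have hm : (0 : ℝ) < (m + 1 : ℕ) := by positivity
  have h3 : 1 ≤ ((m + 1 : ℕ) : ℝ) ^ s := Real.one_le_rpow (by simp) hs
  rw [← mul_div_assoc, le_div_iff₀ hm]
  have h4 := h.1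
  simp only [Nat.add_sub_cancel] at h4 ⊢
  calc _ = (m * q ^ m + q ^ m) * M := by push_cast; ring
    _ ≤ ε := h4
    _ ≤ _ := le_mul_of_one_le_right hε.le h3

theorem eventually_mul_explorationLength_le (K : ℕ) (A₀ b : ℝ) :
    ∀ᶠ n : ℕ in atTop, K * explorationLength A₀ b n ≤ n := by
  have h1 : Tendsto (fun x : ℝ => Real.log x ^ (2 * (2 * b + 1) / b) / x ^ (1 : ℝ)) atTop
      (nhds 0) :=
    (isLittleO_log_rpow_rpow_atTop _ one_pos).tendsto_div_nhds_zero
  have h2 : Tendsto (fun n : ℕ => K * (|A₀| * (Real.log n ^ (2 * (2 * b + 1) / b) / (n : ℝ) ^ (1 : ℝ))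
      + 1 / (n : ℝ))) atTop (nhds (K * (|A₀| * 0 + 0))) :=
    (((h1.comp tendsto_natCast_atTop_atTop).const_mul _).add
      tendsto_one_div_atTop_nhds_zero_nat).const_mul _
  filter_upwards [h2.eventually_le_const (by simp : (K : ℝ) * (|A₀| * 0 + 0) < 1),
    eventually_ge_atTop 1] with n h hn
  have hn' : (0 : ℝ) < n := by positivity
  have hlog : 0 ≤ Real.log n ^ (2 * (2 * b + 1) / b) :=
    Real.rpow_nonneg (Real.log_natCast_nonneg n) _
  have hN : (explorationLength A₀ b n : ℝ) ≤ |A₀| * Real.log n ^ (2 * (2 * b + 1) / b) + 1 := by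
    have := (Nat.ceil_lt_add_one (mul_nonneg (abs_nonneg A₀) hlog)).le
    refine le_trans ?_ this
    exact Nat.cast_le.2 (Nat.ceil_mono (mul_le_mul_of_nonneg_right (le_abs_self _) hlog))
  rw [Real.rpow_one, ← mul_div_assoc, ← add_div, ← mul_div_assoc, div_le_one hn'] at h
  have := (mul_le_mul_of_nonneg_left hN (Nat.cast_nonneg (α := ℝ) K)).trans h
  exact_mod_cast this

/-- When there are at least two arms, exploration plays arms other than `k` in at least `N`
fixed rounds. -/
theorem IsExploration.exists_finset {Ω : Type*} {K N n : ℕ} {I : ℕ → Ω → Fin K}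
    (h : IsExploration N I) (hK : 2 ≤ K) (hn : K * N ≤ n) (k : Fin K) :
    ∃ S ⊆ Finset.range n, N ≤ S.card ∧ ∀ s ∈ S, ∀ ω, I s ω ≠ k := by
  obtain ⟨σ, hσ, hI⟩ := h
  refine ⟨(Finset.range (K * N)).filter (fun t => ¬ σ t = k), ?_, ?_, ?_⟩
  · exact (Finset.filter_subset _ _).trans (Finset.range_mono hn)
  · have h1 := Finset.card_filter_add_card_filter_not (s := Finset.range (K * N))
      (fun t => σ t = k)
    rw [hσ k, Finset.card_range] at h1
    have h2 := Nat.mul_le_mul_right N hK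
    omega
  · intro s hs ω
    rw [Finset.mem_filter, Finset.mem_range] at hs
    rw [hI s hs.1 ω]
    exact hs.2

end Exploration

end ExtremeBandit

/-! ### The regret lower bound -/

theorem theorem3
    (K : ℕ) (hK : 2 ≤ K)
    (α β C : Fin K → ℝ) (C' : ℝ)
    (hα : ∀ k, 1 < α k)
    -- the optimal arm is the one with the smallest tail index
    (kstar : Fin K) (hkstar : ∀ k, k ≠ kstar → α kstar < α k)
    -- the second smallest tail index is larger than `2 α⋆² / (α⋆ - 1)`
    (hgap : ∀ k, k ≠ kstar → 2 * α kstar ^ 2 / (α kstar - 1) < α k)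
    (b : ℝ) (hb : 1 ≤ b) (hbβ : ∀ k, b ≤ β k)
    (A₀ : ℝ) (hA₀ : 0 < A₀) :
    ∃ c : ℝ, 0 < c ∧
      ∀ ν : Fin K → Measure ℝ,
        (∀ k, ExtremeBandit.IsSecondOrderPareto (α k) (β k) (C k) C' (ν k)) →
        -- rewards have finite expectation (automatic on the positive side, since `1 < α k`)
        (∀ k, Integrable (fun x : ℝ => min x 0) (ν k)) →
        ∀ᶠ n : ℕ in atTop,
          ∀ (D E : ℝ), 0 < D → 0 < E → ∀ r : List ℝ → ℝ,
          ∀ (Ω : Type*) [MeasurableSpace Ω] (P : Measure Ω) [IsProbabilityMeasure P]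
            (X : Fin K → ℕ → Ω → ℝ) (I : ℕ → Ω → Fin K),
            ExtremeBandit.IsRewardTable P ν X →
            (ExtremeBandit.IsExtremeETC n (ExtremeBandit.explorationLength A₀ b n)
                (ExtremeBandit.armIndex (α kstar) b D E r n) X I ∨
              ExtremeBandit.IsExtremeHunter n (ExtremeBandit.explorationLength A₀ b n)
                (ExtremeBandit.armIndex (α kstar) b D E r n) X I) →
            ExtremeBandit.IsOptimalArm P X n kstar ∧
            Integrable (ExtremeBandit.armMax X kstar n) P ∧
            Integrable (ExtremeBandit.strategyMax X I n) P ∧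
            c * (Real.log n ^ (2 * (2 * b + 1) / b) *
                (n : ℝ) ^ (-(1 - 1 / α kstar))) ≤
              ExtremeBandit.expectedRegret P X I kstar n := by

  -- The constant is chosen before the laws, but the positivity of `C kstar` is known only from a
  -- law in the family; if there is none, the claim is vacuous.
  by_cases hpos : ¬ ∃ ν : Fin K → Measure ℝ,
      ∀ k, ExtremeBandit.IsSecondOrderPareto (α k) (β k) (C k) C' (ν k)
  · exact ⟨1, one_pos, fun ν hν => absurd ⟨ν, hν⟩ hpos⟩
  have hC : 0 < C kstar := by
    obtain ⟨ν, hν⟩ := not_not.1 hpos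
    exact (hν kstar).C_pos
  set a := α kstar with ha_def
  have ha1 : 1 < a := hα kstar
  have ha : 0 < a := by linarith
  set κ := Real.exp (-(5 / 2 * C kstar)) * C kstar * 2 ^ (-a) / 2 with hκ_def
  have hκ : 0 < κ := by positivity
  -- Each exploration round off `kstar` costs `κ * (n ^ (1 / a) / n)`; half of the total is given up
  -- to absorb the shortfall.
  refine ⟨κ * A₀ / 2, by positivity, fun ν hν hneg => ?_⟩
  have hint : ∀ k, Integrable (fun x : ℝ => x) (ν k) := fun k =>
    (hν k).integrable_id (hα k) (hneg k)
  have hev : ∀ᶠ x : ℝ in atTop, (1 - 5 / 4 * (C kstar * x ^ (-a)) ≤ cdf (ν kstar) x ∧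
      cdf (ν kstar) x ≤ 1 - 3 / 4 * (C kstar * x ^ (-a))) ∧
      ∀ j, j ≠ kstar → 1 - 1 / 4 * (C kstar * x ^ (-a)) ≤ cdf (ν j) x := by
    refine (hν kstar).eventually_cdf_mem.and (eventually_all.2 fun j => ?_)
    by_cases hj : j = kstar
    · exact Eventually.of_forall fun x h => absurd hj h
    · filter_upwards [(hν j).eventually_le_cdf (hkstar j hj)
        (by linarith : 0 < 1 / 4 * C kstar)] with x hx _
      rwa [← mul_assoc]
  obtain ⟨x₁, hx₁⟩ := eventually_atTop.1 hev
  set x₀ := max x₁ 1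
  have hx₀ : 0 < x₀ := lt_of_lt_of_le one_pos (le_max_right _ _)
  have hx₀' : ∀ x, x₀ ≤ x → x₁ ≤ x := fun x hx => (le_max_left _ _).trans hx
  have hmem := fun x hx => (hx₁ x (hx₀' x hx)).1
  have hdom := fun j hj x hx => (hx₁ x (hx₀' x hx)).2 j hj
  have hq : cdf (ν kstar) x₀ < 1 := by
    have h1 := (hmem x₀ le_rfl).2
    have h2 : 0 < C kstar * x₀ ^ (-a) := mul_pos hC (Real.rpow_pos_of_pos hx₀ _)
    linarith
  have hs : 0 ≤ 1 / a := by positivity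
  have hlarge : Tendsto (fun n : ℕ => (n : ℝ) ^ (1 / a)) atTop atTop :=
    (tendsto_rpow_atTop (by positivity)).comp tendsto_natCast_atTop_atTop
  have hsmall : Tendsto (fun n : ℕ => 5 / 4 * (C kstar / (n : ℝ))) atTop (nhds (5 / 4 * 0)) :=
    (tendsto_const_div_atTop_nhds_zero_nat _).const_mul _
  have hlog : Tendsto (fun n : ℕ => Real.log n) atTop atTop :=
    Real.tendsto_log_atTop.comp tendsto_natCast_atTop_atTop
  have hε : 0 < κ * A₀ / 2 := by positivity
  filter_upwards [hlarge.eventually_ge_atTop x₀,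
    hsmall.eventually_le_const (by norm_num : (5 / 4 * 0 : ℝ) < 1 / 2),
    hlog.eventually_ge_atTop 1, eventually_ge_atTop 1,
    ExtremeBandit.eventually_mul_explorationLength_le K A₀ b,
    ExtremeBandit.eventually_pow_mul_le (M := ∫ y, max (x₀ + 1 - y) 0 ∂(ν kstar))
      (cdf_nonneg _ _) hq hε hs,
    ExtremeBandit.eventually_pow_mul_le (M := ∫ y, max (x₀ + 1 - y) 0 ∂(ν kstar))
      (cdf_nonneg _ _) hq (half_pos hκ) hs]
    with n hxn hCn hlogn hn hKN hexp hexp' D E hD hE r Ω _ P _ X I hX hI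
  have hn0 : (0 : ℝ) < n := by positivity
  have hw : 0 < (n : ℝ) ^ (1 / a) / n := by positivity
  obtain ⟨hstr, hexpl⟩ : ExtremeBandit.IsStrategy X I ∧
      ExtremeBandit.IsExploration (ExtremeBandit.explorationLength A₀ b n) I := by
    rcases hI with hI | hI
    · exact ⟨hI.strategy, hI.exploration⟩
    · exact ⟨hI.strategy, hI.exploration⟩
  refine ⟨fun j hj => ?_, hX.integrable_strategyMax (ExtremeBandit.isStrategy_const X kstar) hint n,
    hX.integrable_strategyMax hstr hint n, ?_⟩
  -- Always pulling `j` is a strategy that misses `kstar` in every round, so `S` is the whole range.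
  · have h1 := hX.integral_strategyMax_add_le (ExtremeBandit.isStrategy_const X j) hint hn ha hC
      hx₀ hmem hdom hxn hCn (Finset.Subset.refl (Finset.range n)) (fun _ _ _ => hj)
    rw [Finset.card_range, ExtremeBandit.strategyMax_const, ← hκ_def] at h1
    have h2 : κ * ((n : ℝ) ^ (1 / a) / n) ≤ n * κ * ((n : ℝ) ^ (1 / a) / n) := by
      refine mul_le_mul_of_nonneg_right (le_mul_of_one_le_left hκ.le ?_) hw.le
      exact_mod_cast hn
    have h3 := mul_pos hκ hw
    linarith
  · obtain ⟨S, hS, hcard, hIS⟩ := hexpl.exists_finset hK hKN kstar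
    have h1 := hX.integral_strategyMax_add_le hstr hint hn ha hC hx₀ hmem hdom hxn hCn hS hIS
    rw [← hκ_def] at h1
    set l := Real.log n ^ (2 * (2 * b + 1) / b)
    have hl : 1 ≤ l := Real.one_le_rpow hlogn (by positivity)
    have h2 : A₀ * l ≤ S.card :=
      (Nat.le_ceil _).trans (Nat.cast_le.2 hcard)
    have h3 : A₀ * l * (κ * ((n : ℝ) ^ (1 / a) / n)) ≤ S.card * (κ * ((n : ℝ) ^ (1 / a) / n)) :=
      mul_le_mul_of_nonneg_right h2 (mul_pos hκ hw).le
    -- The shortfall was bounded without the logarithmic factor; `l ≥ 1` lets half of the gain cover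
    -- it.
    have h4 : κ * A₀ / 2 * ((n : ℝ) ^ (1 / a) / n) ≤ κ * A₀ / 2 * (l * ((n : ℝ) ^ (1 / a) / n)) :=
      mul_le_mul_of_nonneg_left (le_mul_of_one_le_left hw.le hl) hε.le
    have h5 : (n : ℝ) ^ (-(1 - 1 / a)) = (n : ℝ) ^ (1 / a) / n := by
      rw [show -(1 - 1 / a) = 1 / a - 1 by ring, Real.rpow_sub_one hn0.ne']
    rw [h5, ExtremeBandit.expectedRegret]
    linarith
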